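/- Let $\varepsilon\in(0,1)$. There is $\Delta_0=\Delta_0(\varepsilon)$ such that the following holds for every integer $\Delta\ge\Delta_0$. Let $k$ be a positive integer with $(1-\varepsilon)k\ln k\ge\Delta$, set $\ell:=\Delta^{\varepsilon/2}$, and let $G$ be a finite triangle-free graph of maximum degree at most $\Delta$. Then, for every $\delta\in(0,1)$ and every vertex $v\in V(G)$, the graph $G\setminus v$ (that is, $G$ with the vertex $v$ deleted) has a proper $k$-colouring, and the uniformly random proper $k$-colouring $\boldsymbol{\sigma}$ of $G\setminus v$ satisfies \[ \Pr\bigl[\ell_{\boldsymbol{\sigma}}(v)<(1-\delta)\ell\bigr]\le 2\,\mathrm{e}^{-\delta^2\ell/2}, \] where, for a proper colouring $\sigma\colon V(G)\setminus\{v\}\to\{1,\dots,k\}$ of $G\setminus v$, $\ell_\sigma(v):=\bigl|\{1,\dots,k\}\setminus\sigma(N_G(v))\bigr|$ is the number of colours available for $v$ given $\sigma$. -/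

import Mathlib

universe u

namespace SparseColouring

variable {V : Type u}

/-- `G ∖ v`: the graph obtained from `G` by deleting the vertex `v`. -/
abbrev deleteVertex (G : SimpleGraph V) (v : V) : SimpleGraph ({v}ᶜ : Set V) :=
  G.induce {v}ᶜ

/-- The colours that the colouring `σ` of `G ∖ v` leaves available for `v`: all the `k` colours
except those that `σ` gives to the neighbours of `v` in `G`. -/
def availableColours (G : SimpleGraph V) {k : ℕ} (v : V)
    (σ : (deleteVertex G v).Coloring (Fin k)) : Set (Fin k) :=
  Set.univ \ (σ '' {u | G.Adj v u})

/-- The number of colours available for `v` given `σ`. -/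
noncomputable def listSize (G : SimpleGraph V) {k : ℕ} (v : V)
    (σ : (deleteVertex G v).Coloring (Fin k)) : ℕ :=
  (availableColours G v σ).ncard

/-- The uniform distribution on the proper `k`-colourings of a finite graph that has one. -/
noncomputable def uniformColouring {W : Type u} [Finite W] (H : SimpleGraph W) (k : ℕ)
    [Nonempty (H.Coloring (Fin k))] : PMF (H.Coloring (Fin k)) :=
  haveI : Finite (H.Coloring (Fin k)) := DFunLike.finite _
  letI := Fintype.ofFinite (H.Coloring (Fin k))
  PMF.uniformOfFintype (H.Coloring (Fin k))

/-- The probability of the event `A` under the distribution `p`. -/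
noncomputable def prob {Ω : Type u} (p : PMF Ω) (A : Set Ω) : ℝ :=
  (p.toOuterMeasure A).toReal

end SparseColouring

/-! The proof shows, for all vertex sets A and all v outside A, that in a uniform proper colouring
of G[A] the vertex v has fewer than T = k^(3ε/4)/8 free colours with probability at most q = 2e^(-T)
(`mostlyFree`). Since T ≥ ℓ, this is stronger than required. The argument is a strong induction on A
with two failure modes, each costing q/2.

Call a neighbour u of v short if fewer than a constant t of colours are free for it. A uniform
colouring of A is a colouring of A \ u biased by the number of colours free for u. By induction that
number averages at least T/2, so the bias makes u short with probability at most 2tq/T. Markov's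
inequality then makes more than m neighbours short with probability at most q/2.

If at most m neighbours are short, fix the colouring off N(v). As G is triangle-free, the
neighbours' colours are independent and uniform on their lists. Short lists spoil at most tm = εk/8
colours. Convexity gives at least 4T unused colours on average among the rest, and negative
correlation bounds the chance of fewer than T by e^(-T) = q/2. -/

namespace SparseColouring

open Finset

/-! ### Unused colours under independent choices from lists. -/

section Occupancy

variable {C : Type*} [Fintype C] [DecidableEq C]

lemma one_add_sum_le_prod_one_add {ι : Type*} (s : Finset ι) (y : ι → ℝ)
    (hy : ∀ i ∈ s, 0 ≤ y i) : 1 + ∑ i ∈ s, y i ≤ ∏ i ∈ s, (1 + y i) := by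
  classical
  induction s using Finset.induction_on with
  | empty => simp
  | insert a s ha ih =>
    rw [sum_insert ha, prod_insert ha]
    have h1 := ih fun i hi => hy i (mem_insert_of_mem hi)
    have h2 : 0 ≤ y a := hy a (mem_insert_self a s)
    have h3 : 0 ≤ ∑ i ∈ s, y i := sum_nonneg fun i hi => hy i (mem_insert_of_mem hi)
    nlinarith

/-- Dividing by ∏ x and setting y = w/x - w ≥ 0 turns this into 1 + ∑ y ≤ ∏ (1 + y), because ∑ w =
1. It is the effect of adding one more chooser. -/
lemma sum_mul_prod_erase_le (w x : C → ℝ) (hw : ∀ c, 0 ≤ w c) (hw1 : ∑ c, w c = 1)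
    (hx : ∀ c, 0 < x c) (hx1 : ∀ c, x c ≤ 1) :
    ∑ c, w c * ∏ d ∈ univ.erase c, x d ≤ ∏ c, (x c + w c * (1 - x c)) := by
  have hP : 0 < ∏ c, x c := prod_pos fun c _ => hx c
  have h1 : ∀ c, w c * ∏ d ∈ univ.erase c, x d = (∏ d, x d) * (w c / x c) := by
    intro c
    rw [← mul_prod_erase univ x (mem_univ c)]
    have := (hx c).ne'
    field_simp
  have h2 : ∀ c, x c + w c * (1 - x c) = x c * (1 + (w c / x c - w c)) := by
    intro c
    have := (hx c).ne'
    field_simp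
  simp_rw [h1, h2, prod_mul_distrib, ← mul_sum]
  refine mul_le_mul_of_nonneg_left ?_ hP.le
  have h3 := one_add_sum_le_prod_one_add univ (fun c => w c / x c - w c) (by
    intro c _
    rw [sub_nonneg, le_div_iff₀ (hx c)]
    exact mul_le_of_le_one_right (hw c) (hx1 c))
  rw [sum_sub_distrib, hw1] at h3
  linarith

/-- If each `i` picks independently a random colour with law `w i`, then the indicators of the
colours that are picked by nobody satisfy a negative-correlation bound on their joint generating
function. -/
lemma sum_prod_unused_le_fin (n : ℕ) (w : Fin n → C → ℝ) (hw : ∀ i c, 0 ≤ w i c)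
    (hw1 : ∀ i, ∑ c, w i c = 1) (b : C → ℝ) (hb : ∀ c, 0 < b c) (hb1 : ∀ c, b c ≤ 1) :
    ∑ f : Fin n → C, (∏ i, w i (f i)) * ∏ c, (if ∃ i, f i = c then 1 else b c) ≤
      ∏ c, (1 - (∏ i, (1 - w i c)) * (1 - b c)) := by
  induction n generalizing b with
  | zero => simp
  | succ n ih =>
    have hle : ∀ i c, w i c ≤ 1 := fun i c => by
      rw [← hw1 i]; exact single_le_sum (fun d _ => hw i d) (mem_univ c)
    set p : C → ℝ := fun c => ∏ i : Fin n, (1 - w i.succ c) with hp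
    have hp0 : ∀ c, 0 ≤ p c := fun c => prod_nonneg fun i _ => by linarith [hle i.succ c]
    have hp1 : ∀ c, p c ≤ 1 := fun c =>
      prod_le_one (fun i _ => by linarith [hle i.succ c]) fun i _ => by linarith [hw i.succ c]
    set x : C → ℝ := fun c => 1 - p c * (1 - b c) with hx
    rw [← (Fin.consEquiv fun _ : Fin (n + 1) => C).sum_comp, Fintype.sum_prod_type]
    have key : ∀ a : C, ∑ f : Fin n → C, (∏ i, w i ((Fin.cons a f : Fin (n + 1) → C) i)) *
        ∏ c, (if ∃ i, (Fin.cons a f : Fin (n + 1) → C) i = c then 1 else b c) ≤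
        w 0 a * ∏ d ∈ univ.erase a, x d := by
      intro a
      -- Once the first chooser has taken `a`, that colour is used whatever follows, so its weight
      -- becomes 1.
      have h := ih (fun i => w i.succ) (fun i => hw i.succ) (fun i => hw1 i.succ)
        (Function.update b a 1)
        (fun c => by
          by_cases h : c = a
          · subst h; simp
          · simpa [Function.update_of_ne h] using hb c)
        (fun c => by
          by_cases h : c = a
          · subst h; simp
          · simpa [Function.update_of_ne h] using hb1 c)
      have h2 : ∏ c, (1 - (∏ i : Fin n, (1 - w i.succ c)) * (1 - Function.update b a 1 c)) =
          ∏ d ∈ univ.erase a, x d := by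
        rw [← mul_prod_erase univ _ (mem_univ a)]
        simp only [Function.update_self, sub_self, mul_zero, sub_zero, one_mul]
        refine prod_congr rfl fun d hd => ?_
        rw [Function.update_of_ne (ne_of_mem_erase hd)]
      rw [h2] at h
      refine le_trans (le_of_eq ?_) (mul_le_mul_of_nonneg_left h (hw 0 a))
      rw [mul_sum]
      refine sum_congr rfl fun f _ => ?_
      rw [Fin.prod_univ_succ]
      simp only [Fin.cons_zero, Fin.cons_succ, mul_assoc]
      congr 2
      refine prod_congr rfl fun c _ => ?_
      by_cases hc : c = a
      · subst hc
        simp [Fin.exists_fin_succ]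
      · simp [Fin.exists_fin_succ, Function.update_of_ne hc, Ne.symm hc]
    refine (sum_le_sum fun a _ => key a).trans ?_
    refine (sum_mul_prod_erase_le (w 0) x (hw 0) (hw1 0) (fun c => ?_) (fun c => ?_)).trans
      (le_of_eq (prod_congr rfl fun c _ => ?_))
    · have := hb c; have := hb1 c; have := hp0 c; have := hp1 c
      simp only [hx]; nlinarith
    · have := hb1 c; have := hp0 c
      simp only [hx]; nlinarith
    · rw [Fin.prod_univ_succ]
      simp only [hx, hp]; ring

lemma sum_prod_unused_le {ι : Type*} [Fintype ι] [DecidableEq ι] (w : ι → C → ℝ)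
    (hw : ∀ i c, 0 ≤ w i c)
    (hw1 : ∀ i, ∑ c, w i c = 1) (b : C → ℝ) (hb : ∀ c, 0 < b c) (hb1 : ∀ c, b c ≤ 1) :
    ∑ f : ι → C, (∏ i, w i (f i)) * ∏ c, (if ∃ i, f i = c then 1 else b c) ≤
      ∏ c, (1 - (∏ i, (1 - w i c)) * (1 - b c)) := by
  have e := Fintype.equivFin ι
  have h := sum_prod_unused_le_fin _ (fun i => w (e.symm i)) (fun i => hw _) (fun i => hw1 _)
    b hb hb1
  rw [← (e.arrowCongr (Equiv.refl C)).sum_comp] at h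
  simp only [fun c => e.symm.prod_comp (fun i => 1 - w i c)] at h
  refine le_trans (le_of_eq (sum_congr rfl fun f _ => ?_)) h
  rw [← e.symm.prod_comp (fun i => w i (f i))]
  congr 1
  refine prod_congr rfl fun c _ => ?_
  simp [e.symm.surjective.exists]

/-- The probability that a uniformly random element of `L` differs from `c`. -/
noncomputable def avoidProb (L : Finset C) (c : C) : ℝ :=
  1 - if c ∈ L then ((#L : ℕ) : ℝ)⁻¹ else 0

/-- Lower tail for the number of colours not used by independent uniform choices from lists. -/
lemma card_few_unused_le {ι : Type*} [Fintype ι] [DecidableEq ι] (L : ι → Finset C)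
    (hL : ∀ i, (L i).Nonempty) (K : Finset C) (T : ℝ) :
    (#{g ∈ Fintype.piFinset L | ((#{c | ∀ i, g i ≠ c} : ℕ) : ℝ) < T} : ℝ) ≤
      Real.exp (T - (∑ c ∈ K, ∏ i, avoidProb (L i) c) / 2) * #(Fintype.piFinset L) := by
  have hcard : ∀ i, (0 : ℝ) < #(L i) := fun i => by exact_mod_cast (hL i).card_pos
  set w : ι → C → ℝ := fun i c => if c ∈ L i then ((#(L i) : ℕ) : ℝ)⁻¹ else 0 with hwdef
  have hw : ∀ i c, 0 ≤ w i c := fun i c => by simp only [hwdef]; split_ifs <;> positivity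
  have hw1 : ∀ i, ∑ c, w i c = 1 := fun i => by
    simp only [hwdef, sum_ite_mem, univ_inter, sum_const, nsmul_eq_mul]
    exact mul_inv_cancel₀ (hcard i).ne'
  have hle : ∀ i c, w i c ≤ 1 := fun i c => by
    rw [← hw1 i]; exact single_le_sum (fun d _ => hw i d) (mem_univ c)
  -- Chernoff with weight 1/2 per unused colour of `K`: the mean is at most exp(-E/2), where E is
  -- the expected number of unused colours in `K`. As 1/2 ≥ e^(-1), fewer than `T` unused colours
  -- force a product of at least e^(-T).
  set b : C → ℝ := fun c => if c ∈ K then 1 / 2 else 1 with hbdef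
  have hb : ∀ c, 0 < b c := fun c => by simp only [hbdef]; split_ifs <;> norm_num
  have hb1 : ∀ c, b c ≤ 1 := fun c => by simp only [hbdef]; split_ifs <;> norm_num
  have hbh : ∀ c, 1 / 2 ≤ b c := fun c => by simp only [hbdef]; split_ifs <;> norm_num
  have main := sum_prod_unused_le w hw hw1 b hb hb1
  have hprob : ∀ i c, 1 - w i c = avoidProb (L i) c := fun i c => rfl
  simp only [hprob] at main
  have hN : (#(Fintype.piFinset L) : ℝ) = ∏ i, (#(L i) : ℝ) := by
    rw [Fintype.card_piFinset]; push_cast; rfl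
  have hNpos : (0 : ℝ) < #(Fintype.piFinset L) := by
    rw [hN]; exact prod_pos fun i _ => hcard i
  have hR : ∏ c, (1 - (∏ i, avoidProb (L i) c) * (1 - b c)) ≤
      Real.exp (-((∑ c ∈ K, ∏ i, avoidProb (L i) c) / 2)) := by
    have : ∀ c, 1 - (∏ i, avoidProb (L i) c) * (1 - b c) ≤
        Real.exp (-(if c ∈ K then (∏ i, avoidProb (L i) c) / 2 else 0)) := by
      intro c
      simp only [hbdef]
      split_ifs with h
      · have := Real.add_one_le_exp (-((∏ i, avoidProb (L i) c) / 2))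
        linarith
      · simp
    refine (prod_le_prod (fun c _ => ?_) fun c _ => this c).trans (le_of_eq ?_)
    · have h0 : 0 ≤ ∏ i, avoidProb (L i) c := prod_nonneg fun i _ => by
        rw [← hprob]; linarith [hle i c]
      have h1 : ∏ i, avoidProb (L i) c ≤ 1 := prod_le_one
        (fun i _ => by rw [← hprob]; linarith [hle i c])
        fun i _ => by rw [← hprob]; linarith [hw i c]
      have := hb c; have := hb1 c
      nlinarith
    · rw [← Real.exp_sum, sum_neg_distrib, sum_ite_mem, univ_inter, sum_div]
  have hlow : (#{g ∈ Fintype.piFinset L | ((#{c | ∀ i, g i ≠ c} : ℕ) : ℝ) < T} : ℝ) *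
      ((#(Fintype.piFinset L) : ℝ)⁻¹ * Real.exp (-T)) ≤
      ∑ f : ι → C, (∏ i, w i (f i)) * ∏ c, (if ∃ i, f i = c then 1 else b c) := by
    rw [← nsmul_eq_mul, ← sum_const]
    refine (sum_le_sum fun g hg => ?_).trans (sum_le_sum_of_subset_of_nonneg
      (subset_univ _) fun g _ _ => mul_nonneg (prod_nonneg fun i _ => hw i _)
        (prod_nonneg fun c _ => by split_ifs <;> [norm_num; exact (hb c).le]))
    rw [mem_filter, Fintype.mem_piFinset] at hg
    have e1 : ∏ i, w i (g i) = (#(Fintype.piFinset L) : ℝ)⁻¹ := by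
      rw [hN, ← prod_inv_distrib]
      exact prod_congr rfl fun i _ => by simp [hwdef, hg.1 i]
    rw [e1]
    refine mul_le_mul_of_nonneg_left ?_ (by positivity)
    have e2 : ∏ c, (if c ∈ ({c | ∀ i, g i ≠ c} : Finset C) then Real.exp (-1) else 1) =
        Real.exp (-(#{c | ∀ i, g i ≠ c} : ℕ)) := by
      rw [prod_ite_mem, univ_inter, prod_const, ← Real.exp_nat_mul]
      simp
    calc Real.exp (-T) ≤ Real.exp (-(#{c | ∀ i, g i ≠ c} : ℕ)) :=
          Real.exp_le_exp.2 (by linarith [hg.2])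
      _ ≤ _ := by
          rw [← e2]
          refine prod_le_prod (fun c _ => by split_ifs <;> positivity) fun c _ => ?_
          by_cases hc : ∃ i, g i = c
          · have : ¬ ∀ i, g i ≠ c := fun h => hc.elim h
            simp [hc, this]
          · have h3 : ∀ i, g i ≠ c := fun i hi => hc ⟨i, hi⟩
            have h4 : Real.exp (-1) ≤ 1 / 2 := by
              rw [Real.exp_neg, one_div]
              exact inv_anti₀ (by norm_num) (by linarith [Real.add_one_le_exp (1 : ℝ)])
            simpa [hc, h3] using h4.trans (by simpa using hbh c)
  have := hlow.trans (main.trans hR)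
  rw [sub_eq_add_neg, Real.exp_add]
  have h5 : Real.exp T * Real.exp (-T) = 1 := by rw [← Real.exp_add]; simp
  have h6 := mul_le_mul_of_nonneg_left this
    (mul_nonneg (Real.exp_pos T).le hNpos.le)
  calc _ = Real.exp T * (#(Fintype.piFinset L) : ℝ) *
        ((#{g ∈ Fintype.piFinset L | ((#{c | ∀ i, g i ≠ c} : ℕ) : ℝ) < T} : ℝ) *
        ((#(Fintype.piFinset L) : ℝ)⁻¹ * Real.exp (-T))) := by
        have : ∀ a b c d : ℝ, c ≠ 0 → a * d = 1 → b = a * c * (b * (c⁻¹ * d)) := by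
          intro a b c d hc h
          field_simp
          linear_combination -b * h
        exact this _ _ _ _ hNpos.ne' h5
    _ ≤ _ := h6
    _ = _ := by ring

/-- Lower bound for the expected number of colours in `K` left unused by independent uniform
choices from the lists `L i`, when every list that meets `K` has size at least `t`. -/
lemma le_sum_prod_avoidProb {ι : Type*} [Fintype ι] [DecidableEq ι] (L : ι → Finset C)
    (t : ℕ) (ht : 2 ≤ t) (K : Finset C) (κ : ℝ) (hκ : 0 < κ) (hK : κ ≤ #K)
    (hbad : ∀ i, #(L i) < t → Disjoint (L i) K) (D : ℝ) (hD : (Fintype.card ι : ℝ) ≤ D) :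
    κ * Real.exp (-(D * (t / (t - 1)) / κ)) ≤ ∑ c ∈ K, ∏ i, avoidProb (L i) c := by
  have ht' : (2 : ℝ) ≤ t := by exact_mod_cast ht
  -- From 1 - 1/n = (1 + 1/(n-1))⁻¹ ≥ exp(-1/(n-1)). A list of size n ≥ t contributes at most
  -- n/(n-1) ≤ t/(t-1) in total.
  set s : ι → C → ℝ := fun i c => if c ∈ L i ∧ t ≤ #(L i) then ((#(L i) : ℝ) - 1)⁻¹ else 0 with hs
  have h1 : ∀ c ∈ K, Real.exp (-∑ i, s i c) ≤ ∏ i, avoidProb (L i) c := by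
    intro c hc
    rw [← sum_neg_distrib, Real.exp_sum]
    refine prod_le_prod (fun i _ => (Real.exp_pos _).le) fun i _ => ?_
    simp only [hs, avoidProb]
    by_cases hci : c ∈ L i
    · have hti : t ≤ #(L i) := by
        by_contra hlt
        exact disjoint_left.1 (hbad i (not_le.1 hlt)) hci hc
      have hn : (2 : ℝ) ≤ #(L i) := ht'.trans (by exact_mod_cast hti)
      simp only [hci, hti, and_self, if_true]
      have h2 := Real.add_one_le_exp (((#(L i) : ℝ) - 1)⁻¹)
      rw [Real.exp_neg]
      have h3 : 1 - (#(L i) : ℝ)⁻¹ = (((#(L i) : ℝ) - 1)⁻¹ + 1)⁻¹ := by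
        have h4 : (#(L i) : ℝ) - 1 ≠ 0 := by linarith
        have h5 : (#(L i) : ℝ) ≠ 0 := by linarith
        have h6 : ((#(L i) : ℝ) - 1)⁻¹ + 1 = #(L i) / (#(L i) - 1) := by
          rw [eq_div_iff h4, add_mul, inv_mul_cancel₀ h4]
          ring
        rw [h6, inv_div, sub_div, div_self h5, one_div]
      rw [h3]
      have : 0 < ((#(L i) : ℝ) - 1)⁻¹ := inv_pos.2 (by linarith)
      exact inv_anti₀ (by linarith) h2
    · simp [hci]
  have h2 : ∑ c ∈ K, ∑ i, s i c ≤ D * (t / (t - 1)) := by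
    rw [sum_comm]
    have h3 : ∀ i, ∑ c ∈ K, s i c ≤ (t / (t - 1) : ℝ) := by
      intro i
      refine (sum_le_sum_of_subset_of_nonneg (subset_univ K) fun c _ _ => ?_).trans ?_
      · simp only [hs]
        split_ifs with h
        · have : (2 : ℝ) ≤ #(L i) := ht'.trans (by exact_mod_cast h.2)
          exact inv_nonneg.2 (by linarith)
        · rfl
      · by_cases hti : t ≤ #(L i)
        · have hn : (t : ℝ) ≤ #(L i) := by exact_mod_cast hti
          simp only [hs, hti, and_true, sum_ite_mem, univ_inter, sum_const, nsmul_eq_mul]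
          rw [← div_eq_mul_inv, div_le_div_iff₀ (by linarith) (by linarith)]
          nlinarith
        · simp only [hs, hti, and_false, if_false, sum_const_zero]
          exact div_nonneg (by linarith) (by linarith)
    refine (sum_le_sum fun i _ => h3 i).trans ?_
    rw [sum_const, nsmul_eq_mul, card_univ]
    exact mul_le_mul_of_nonneg_right hD (div_nonneg (by linarith) (by linarith))
  set a : ℝ := D * (t / (t - 1)) / κ with ha
  have ha0 : 0 ≤ a := div_nonneg (mul_nonneg ((Nat.cast_nonneg _).trans hD)
    (div_nonneg (by linarith) (by linarith))) hκ.le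
  -- Jensen's inequality via the tangent line of exp at -a; since `a * κ` bounds the total exponent,
  -- summing over `K` leaves at least κe^(-a).
  have h4 : ∀ c ∈ K, Real.exp (-a) * (1 + a - ∑ i, s i c) ≤ ∏ i, avoidProb (L i) c := by
    intro c hc
    refine le_trans ?_ (h1 c hc)
    have := Real.add_one_le_exp (a - ∑ i, s i c)
    calc _ ≤ Real.exp (-a) * Real.exp (a - ∑ i, s i c) :=
          mul_le_mul_of_nonneg_left (by linarith) (Real.exp_pos _).le
      _ = _ := by rw [← Real.exp_add]; congr 1; ring
  refine le_trans ?_ (sum_le_sum h4)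
  rw [← mul_sum, sum_sub_distrib, sum_const, nsmul_eq_mul, mul_comm]
  refine mul_le_mul_of_nonneg_left ?_ (Real.exp_pos _).le
  have h5 : a * κ = D * (t / (t - 1)) := by rw [ha]; field_simp
  nlinarith

end Occupancy

/-! ### Invariance of uniform measure under resampling. -/

section Resampling

variable {V C : Type*} [DecidableEq V]

/-- Replace the values of `f` on `U` by those of `g`. -/
def overwrite (U : Finset V) (f : V → C) (g : U → C) (x : V) : C :=
  if h : x ∈ U then g ⟨x, h⟩ else f x

lemma overwrite_of_mem {U : Finset V} (f : V → C) (g : U → C) {x : V} (h : x ∈ U) :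
    overwrite U f g x = g ⟨x, h⟩ := dif_pos h

lemma overwrite_of_notMem {U : Finset V} (f : V → C) (g : U → C) {x : V} (h : x ∉ U) :
    overwrite U f g x = f x := dif_neg h

variable [Fintype V] [Fintype C]

/-- Exchanging `g` with the restriction of `f` to `U` is an involution on pairs, so resampling `U`
preserves counts. This replaces conditioning on the values off `U`. -/
lemma card_mul_card_filter_eq_sum_overwrite (U : Finset V) (P : (V → C) → Prop)
    [DecidablePred P] :
    Fintype.card (U → C) * #{f | P f} = ∑ f : V → C, #{g : U → C | P (overwrite U f g)} := by
  let swap : (V → C) × (U → C) → (V → C) × (U → C) :=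
    fun p => (overwrite U p.1 p.2, fun x => p.1 x)
  have hswap : Function.Involutive swap := by
    rintro ⟨f, g⟩
    refine Prod.ext (funext fun x => ?_) (funext fun x => ?_)
    · by_cases h : x ∈ U
      · simp [swap, overwrite_of_mem _ _ h]
      · simp [swap, overwrite_of_notMem _ _ h]
    · simp [swap, overwrite_of_mem _ _ x.2]
  simp only [card_filter]
  rw [← Fintype.sum_prod_type' (f := fun (f : V → C) (g : U → C) =>
    if P (overwrite U f g) then 1 else 0)]
  have h := Equiv.sum_comp hswap.toPerm (fun p : (V → C) × (U → C) => if P p.1 then 1 else 0)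
  refine Eq.trans ?_ h.symm
  rw [Fintype.sum_prod_type, sum_comm]
  simp

lemma card_mul_card_filter_eq_sum_update (u : V) (P : (V → C) → Prop) [DecidablePred P] :
    Fintype.card C * #{f | P f} = ∑ f : V → C, #{c : C | P (Function.update f u c)} := by
  let swap : (V → C) × C → (V → C) × C := fun p => (Function.update p.1 u p.2, p.1 u)
  have hswap : Function.Involutive swap := by
    rintro ⟨f, g⟩
    simp [swap]
  simp only [card_filter]
  rw [← Fintype.sum_prod_type' (f := fun (f : V → C) (c : C) =>
    if P (Function.update f u c) then 1 else 0)]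
  have h := Equiv.sum_comp hswap.toPerm (fun p : (V → C) × C => if P p.1 then 1 else 0)
  refine Eq.trans ?_ h.symm
  rw [Fintype.sum_prod_type, sum_comm]
  simp

end Resampling

/-! ### The induction over induced subgraphs. -/

section PartialColourings

variable {V : Type*} [Fintype V] [DecidableEq V] (G : SimpleGraph V) [DecidableRel G.Adj] {k : ℕ}

/-- The maps `V → Fin k` that colour the subgraph induced by `A` properly. -/
def properOn (k : ℕ) (A : Finset V) : Finset (V → Fin k) :=
  {f | ∀ x ∈ A, ∀ y ∈ A, G.Adj x y → f x ≠ f y}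

/-- The colours that `f` does not use on the neighbours of `v` in `A`. -/
def freeColours (f : V → Fin k) (A : Finset V) (v : V) : Finset (Fin k) :=
  {c | ∀ u ∈ A, G.Adj v u → f u ≠ c}

variable {G}

lemma mem_properOn {f : V → Fin k} {A : Finset V} :
    f ∈ properOn G k A ↔ ∀ x ∈ A, ∀ y ∈ A, G.Adj x y → f x ≠ f y := by
  simp [properOn]

lemma mem_freeColours {f : V → Fin k} {A : Finset V} {v : V} {c : Fin k} :
    c ∈ freeColours G f A v ↔ ∀ u ∈ A, G.Adj v u → f u ≠ c := by
  simp [freeColours]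

lemma freeColours_congr {f f' : V → Fin k} {A A' : Finset V} {v : V}
    (hA : ∀ u, G.Adj v u → (u ∈ A ↔ u ∈ A')) (hf : ∀ u ∈ A, G.Adj v u → f u = f' u) :
    freeColours G f A v = freeColours G f' A' v := by
  ext c
  simp only [mem_freeColours]
  refine forall_congr' fun u => ⟨fun h h1 h2 => ?_, fun h h1 h2 => ?_⟩
  · rw [← hf u ((hA u h2).2 h1) h2]; exact h ((hA u h2).2 h1) h2
  · rw [hf u h1 h2]; exact h ((hA u h2).1 h1) h2

lemma update_mem_properOn_insert {A : Finset V} {u : V} (hu : u ∉ A) (f : V → Fin k) (c : Fin k) :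
    Function.update f u c ∈ properOn G k (insert u A) ↔
      f ∈ properOn G k A ∧ c ∈ freeColours G f A u := by
  have hne : ∀ x ∈ A, x ≠ u := fun x hx h => hu (h ▸ hx)
  simp only [mem_properOn, mem_freeColours]
  constructor
  · refine fun h => ⟨fun x hx y hy hxy => ?_, fun x hx hxy => ?_⟩
    · simpa [Function.update_of_ne (hne x hx), Function.update_of_ne (hne y hy)] using
        h x (mem_insert_of_mem hx) y (mem_insert_of_mem hy) hxy
    · simpa [Function.update_of_ne (hne x hx)] using
        h x (mem_insert_of_mem hx) u (mem_insert_self u A) hxy.symm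
  · rintro ⟨h1, h2⟩ x hx y hy hxy
    rcases mem_insert.1 hx with rfl | hxA
    · rcases mem_insert.1 hy with rfl | hyA
      · exact absurd hxy (G.irrefl)
      · simpa [Function.update_of_ne (hne y hyA)] using (h2 y hyA hxy).symm
    · rcases mem_insert.1 hy with rfl | hyA
      · simpa [Function.update_of_ne (hne x hxA)] using h2 x hxA hxy.symm
      · simpa [Function.update_of_ne (hne x hxA), Function.update_of_ne (hne y hyA)] using
          h1 x hxA y hyA hxy

/-- A uniform colouring of `insert u A` restricts to a colouring of `A` biased by the number of
colours that are free for `u`. -/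
lemma mul_card_properOn_insert {A : Finset V} {u : V} (hu : u ∉ A) (R : (V → Fin k) → Prop)
    [DecidablePred R] (hR : ∀ f c, R (Function.update f u c) ↔ R f) :
    k * #{f ∈ properOn G k (insert u A) | R f} =
      ∑ f ∈ properOn G k A with R f, #(freeColours G f A u) := by
  -- Colourings of `A` are counted as maps on all of `V`, so the value at `u` is arbitrary there;
  -- this is the origin of the factor `k`.
  have h := card_mul_card_filter_eq_sum_update u
    (fun f : V → Fin k => f ∈ properOn G k (insert u A) ∧ R f)
  rw [Fintype.card_fin] at h
  have e : ({f ∈ properOn G k (insert u A) | R f} : Finset _) =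
      ({f | f ∈ properOn G k (insert u A) ∧ R f} : Finset (V → Fin k)) := by ext; simp
  have e' : ({f ∈ properOn G k A | R f} : Finset _) =
      ({f | f ∈ properOn G k A ∧ R f} : Finset (V → Fin k)) := by ext; simp
  rw [e, h, e', sum_filter]
  refine sum_congr rfl fun f _ => ?_
  simp only [update_mem_properOn_insert hu, hR]
  split_ifs with h1
  · congr 1
    ext c
    simp [h1]
  · rw [card_eq_zero, filter_eq_empty_iff]
    rintro c - ⟨⟨h2, -⟩, h3⟩
    exact h1 ⟨h2, h3⟩

variable (G) in
/-- In all but a proportion `q` of the colourings of `A`, the vertex `v` has at least `T` free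
colours. -/
def MostlyFree (k : ℕ) (T q : ℝ) (A : Finset V) (v : V) : Prop :=
  (#{f ∈ properOn G k A | (#(freeColours G f A v) : ℝ) < T} : ℝ) ≤ q * #(properOn G k A)

/-- At least half of the colourings of `A` leave `T` or more colours for `u`, so the average number
of extensions is at least `T / 2`. -/
lemma MostlyFree.card_properOn_le {T q : ℝ} (hT : 0 < T) (hq : q ≤ 1 / 2) {A : Finset V} {u : V}
    (hu : u ∉ A) (h : MostlyFree G k T q A u) :
    T / 2 * #(properOn G k A) ≤ k * #(properOn G k (insert u A)) := by
  have h1 := mul_card_properOn_insert (G := G) (k := k) hu (fun _ => True) (by simp)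
  simp only [filter_true] at h1
  have h2 : (k : ℝ) * #(properOn G k (insert u A)) =
      ∑ f ∈ properOn G k A, (#(freeColours G f A u) : ℝ) := by exact_mod_cast h1
  rw [h2]
  have h3 := card_filter_add_card_filter_not (s := properOn G k A)
    (fun f => (#(freeColours G f A u) : ℝ) < T)
  have h3' : (#{f ∈ properOn G k A | (#(freeColours G f A u) : ℝ) < T} : ℝ) +
      #{f ∈ properOn G k A | ¬ (#(freeColours G f A u) : ℝ) < T} = #(properOn G k A) := by
    exact_mod_cast h3
  unfold MostlyFree at h
  have h4 : (#{f ∈ properOn G k A | ¬ (#(freeColours G f A u) : ℝ) < T} : ℝ) * T ≤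
      ∑ f ∈ properOn G k A, (#(freeColours G f A u) : ℝ) := by
    rw [← nsmul_eq_mul, ← sum_const]
    refine (sum_le_sum fun f hf => ?_).trans
      (sum_le_sum_of_subset_of_nonneg (filter_subset _ _) fun _ _ _ => by positivity)
    exact not_lt.1 (mem_filter.1 hf).2
  have h5 : (0 : ℝ) ≤ #(properOn G k A) := by positivity
  have h6 : 1 / 2 * (#(properOn G k A) : ℝ) ≤
      #{f ∈ properOn G k A | ¬ (#(freeColours G f A u) : ℝ) < T} := by nlinarith
  nlinarith

/-- Size bias: a colouring with fewer than `t` free colours at `u` has fewer than `t` extensions,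
against an average of at least `T / 2`. The gain 2t/T over `q` pays for the later sum over
neighbours. -/
lemma MostlyFree.card_few_free_le {T q : ℝ} (hq : q ≤ 1 / 2) {t : ℕ} (htT : (t : ℝ) ≤ T)
    (hT : 0 < T) (hk : 0 < k) {A : Finset V} {u : V} (hu : u ∉ A) (h : MostlyFree G k T q A u)
    (hq0 : 0 ≤ q) :
    T * #{f ∈ properOn G k (insert u A) | #(freeColours G f A u) < t} ≤
      2 * t * q * #(properOn G k (insert u A)) := by
  have h1 := mul_card_properOn_insert (G := G) (k := k) hu
    (fun f => #(freeColours G f A u) < t) (fun f c => by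
      rw [freeColours_congr (fun _ _ => Iff.rfl) fun x hx _ =>
        Function.update_of_ne (fun h : x = u => hu (h ▸ hx)) c f])
  have h2 : ∑ f ∈ properOn G k A with #(freeColours G f A u) < t, #(freeColours G f A u) ≤
      #{f ∈ properOn G k A | #(freeColours G f A u) < t} * t := by
    rw [← smul_eq_mul, ← sum_const]
    exact sum_le_sum fun f hf => (mem_filter.1 hf).2.le
  rw [← h1] at h2
  have h2' : (k : ℝ) * #{f ∈ properOn G k (insert u A) | #(freeColours G f A u) < t} ≤
      #{f ∈ properOn G k A | #(freeColours G f A u) < t} * t := by exact_mod_cast h2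
  have h3 : (#{f ∈ properOn G k A | #(freeColours G f A u) < t} : ℝ) ≤
      q * #(properOn G k A) := by
    refine le_trans ?_ h
    refine Nat.cast_le.2 (card_le_card fun f hf => ?_)
    rw [mem_filter] at hf ⊢
    exact ⟨hf.1, lt_of_lt_of_le (by exact_mod_cast hf.2) htT⟩
  have h4 := h.card_properOn_le hT hq hu
  have hk' : (0 : ℝ) < k := by exact_mod_cast hk
  refine le_of_mul_le_mul_left ?_ hk'
  have ht0 : (0 : ℝ) ≤ t := by positivity
  calc (k : ℝ) * (T * #{f ∈ properOn G k (insert u A) | #(freeColours G f A u) < t})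
      = T * (k * #{f ∈ properOn G k (insert u A) | #(freeColours G f A u) < t}) := by ring
    _ ≤ T * (q * #(properOn G k A) * t) := by
        refine mul_le_mul_of_nonneg_left (h2'.trans ?_) hT.le
        exact mul_le_mul_of_nonneg_right h3 ht0
    _ = 2 * t * q * (T / 2 * #(properOn G k A)) := by ring
    _ ≤ 2 * t * q * (k * #(properOn G k (insert u A))) :=
        mul_le_mul_of_nonneg_left h4 (by positivity)
    _ = _ := by ring

/-- The neighbours of `v` in `A`. -/
def nbrsIn (G : SimpleGraph V) [DecidableRel G.Adj] (A : Finset V) (v : V) : Finset V :=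
  {u ∈ A | G.Adj v u}

lemma not_adj_of_mem_nbrsIn (hG : G.CliqueFree 3) {A : Finset V} {v x y : V}
    (hx : x ∈ nbrsIn G A v) (hy : y ∈ nbrsIn G A v) : ¬ G.Adj x y := by
  intro hxy
  simp only [nbrsIn, mem_filter] at hx hy
  exact hG {v, x, y} (SimpleGraph.is3Clique_triple_iff.2 ⟨hx.2, hy.2, hxy⟩)

lemma freeColours_overwrite (hG : G.CliqueFree 3) {A : Finset V} {v u : V}
    (hu : u ∈ nbrsIn G A v) (f : V → Fin k) (g : nbrsIn G A v → Fin k) :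
    freeColours G (overwrite (nbrsIn G A v) f g) A u =
      freeColours G f (A \ nbrsIn G A v) u := by
  have hn : ∀ x, G.Adj u x → x ∉ nbrsIn G A v := fun x hx hxn =>
    not_adj_of_mem_nbrsIn hG hu hxn hx
  exact freeColours_congr (fun x hx => by simp [hn x hx])
    fun x _ hx => overwrite_of_notMem _ _ (hn x hx)

lemma freeColours_overwrite_self {A : Finset V} {v : V} (f : V → Fin k)
    (g : nbrsIn G A v → Fin k) :
    freeColours G (overwrite (nbrsIn G A v) f g) A v =
      ({c | ∀ i, g i ≠ c} : Finset (Fin k)) := by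
  ext c
  simp only [mem_freeColours, mem_filter, mem_univ, true_and]
  constructor
  · rintro h ⟨u, hu⟩
    have := h u (mem_filter.1 hu).1 (mem_filter.1 hu).2
    rwa [overwrite_of_mem _ _ hu] at this
  · intro h u huA huv
    have hu : u ∈ nbrsIn G A v := mem_filter.2 ⟨huA, huv⟩
    rw [overwrite_of_mem _ _ hu]
    exact h _

/-- No edge joins two neighbours of `v`, so once the rest is fixed their colours range over a full
product of lists: they are independent and uniform. -/
lemma overwrite_mem_properOn (hG : G.CliqueFree 3) {A : Finset V} {v : V} (f : V → Fin k)
    (g : nbrsIn G A v → Fin k) :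
    overwrite (nbrsIn G A v) f g ∈ properOn G k A ↔ f ∈ properOn G k (A \ nbrsIn G A v) ∧
      g ∈ Fintype.piFinset fun u : nbrsIn G A v =>
        freeColours G f (A \ nbrsIn G A v) (u : V) := by
  have hsub : ∀ {x}, x ∈ nbrsIn G A v → x ∈ A := fun hx => (mem_filter.1 hx).1
  simp only [mem_properOn, Fintype.mem_piFinset, mem_freeColours]
  constructor
  · refine fun h => ⟨fun x hx y hy hxy => ?_, fun u x hx hux => ?_⟩
    · have := h x (mem_sdiff.1 hx).1 y (mem_sdiff.1 hy).1 hxy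
      rwa [overwrite_of_notMem _ _ (mem_sdiff.1 hx).2,
        overwrite_of_notMem _ _ (mem_sdiff.1 hy).2] at this
    · have := h x (mem_sdiff.1 hx).1 u (hsub u.2) hux.symm
      rwa [overwrite_of_notMem _ _ (mem_sdiff.1 hx).2, overwrite_of_mem _ _ u.2] at this
  · rintro ⟨h1, h2⟩ x hx y hy hxy
    by_cases hxU : x ∈ nbrsIn G A v <;> by_cases hyU : y ∈ nbrsIn G A v
    · exact absurd hxy (not_adj_of_mem_nbrsIn hG hxU hyU)
    · rw [overwrite_of_mem _ _ hxU, overwrite_of_notMem _ _ hyU]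
      exact (h2 ⟨x, hxU⟩ y (mem_sdiff.2 ⟨hy, hyU⟩) hxy).symm
    · rw [overwrite_of_mem _ _ hyU, overwrite_of_notMem _ _ hxU]
      exact h2 ⟨y, hyU⟩ x (mem_sdiff.2 ⟨hx, hxU⟩) hxy.symm
    · rw [overwrite_of_notMem _ _ hyU, overwrite_of_notMem _ _ hxU]
      exact h1 x (mem_sdiff.2 ⟨hx, hxU⟩) y (mem_sdiff.2 ⟨hy, hyU⟩) hxy

/-- Lower tail for unused colours when at most `m` of the lists are shorter than `t`. -/
lemma card_few_unused_le_of_few_short {ι : Type*} [Fintype ι] [DecidableEq ι]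
    (L : ι → Finset (Fin k)) (t : ℕ) (ht : 2 ≤ t) (m D T r : ℝ)
    (hmk : t * m < k) (hD : (Fintype.card ι : ℝ) ≤ D)
    (hr : Real.exp (T - (k - t * m) * Real.exp (-(D * (t / (t - 1)) / (k - t * m))) / 2) ≤ r)
    (hbad : (#{i | #(L i) < t} : ℝ) ≤ m) :
    (#{g ∈ Fintype.piFinset L | ((#{c | ∀ i, g i ≠ c} : ℕ) : ℝ) < T} : ℝ) ≤
      r * #(Fintype.piFinset L) := by
  by_cases hL : ∀ i, (L i).Nonempty
  -- Discarding every colour on a short list costs at most `t * m` colours; each list meeting the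
  -- complement has size at least `t`.
  · set S : Finset (Fin k) := ({i | #(L i) < t} : Finset ι).biUnion L
    have hS : (#S : ℝ) ≤ t * m := by
      have h1 : #S ≤ #({i | #(L i) < t} : Finset ι) * t :=
        card_biUnion_le_card_mul _ _ _ fun i hi => (mem_filter.1 hi).2.le
      have h2 : (#S : ℝ) ≤ #({i | #(L i) < t} : Finset ι) * t := by exact_mod_cast h1
      rw [mul_comm]
      exact h2.trans (mul_le_mul_of_nonneg_right hbad (by positivity))
    have hK : (k : ℝ) - t * m ≤ #Sᶜ := by
      have h1 : #Sᶜ + #S = k := by rw [add_comm, card_add_card_compl, Fintype.card_fin]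
      have h2 : (#Sᶜ : ℝ) + #S = k := by exact_mod_cast h1
      linarith
    refine (card_few_unused_le L hL Sᶜ T).trans
      (mul_le_mul_of_nonneg_right (le_trans (Real.exp_le_exp.2 ?_) hr) (by positivity))
    have := le_sum_prod_avoidProb L t ht Sᶜ (k - t * m) (by linarith) hK (fun i hi => by
      refine disjoint_left.2 fun c hc hcS => mem_compl.1 hcS ?_
      refine subset_biUnion_of_mem L (by simpa using hi) hc) D hD
    linarith
  · have : Fintype.piFinset L = ∅ := by
      push Not at hL
      obtain ⟨i, hi⟩ := hL
      refine eq_empty_of_forall_notMem fun g hg => ?_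
      have := Fintype.mem_piFinset.1 hg i
      rw [hi] at this
      exact notMem_empty _ this
    simp [this]

variable {t : ℕ} {m D T q : ℝ}

lemma card_few_free_and_few_short_le (hG : G.CliqueFree 3) (hD : ∀ A v, (#(nbrsIn G A v) : ℝ) ≤ D)
    (ht : 2 ≤ t) (hk : 0 < k) (hmk : t * m < k) {r : ℝ} (hr0 : 0 ≤ r)
    (hr : Real.exp (T - (k - t * m) * Real.exp (-(D * (t / (t - 1)) / (k - t * m))) / 2) ≤ r)
    (A : Finset V) (v : V) :
    (#{f ∈ properOn G k A | (#{u ∈ nbrsIn G A v | #(freeColours G f A u) < t} : ℝ) ≤ m ∧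
      (#(freeColours G f A v) : ℝ) < T} : ℝ) ≤ r * #(properOn G k A) := by
  set U := nbrsIn G A v with hU
  have h1 := card_mul_card_filter_eq_sum_overwrite U (fun f : V → Fin k => f ∈ properOn G k A ∧
    (#{u ∈ U | #(freeColours G f A u) < t} : ℝ) ≤ m ∧ (#(freeColours G f A v) : ℝ) < T)
  have h2 := card_mul_card_filter_eq_sum_overwrite U (fun f : V → Fin k => f ∈ properOn G k A)
  have e1 : ({f ∈ properOn G k A | (#{u ∈ U | #(freeColours G f A u) < t} : ℝ) ≤ m ∧
      (#(freeColours G f A v) : ℝ) < T} : Finset _) =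
      ({f | f ∈ properOn G k A ∧ (#{u ∈ U | #(freeColours G f A u) < t} : ℝ) ≤ m ∧
      (#(freeColours G f A v) : ℝ) < T} : Finset (V → Fin k)) := by ext; simp
  have e2 : ({f | f ∈ properOn G k A} : Finset (V → Fin k)) = properOn G k A := by ext; simp
  rw [e2] at h2
  rw [e1]
  have hc : (0 : ℝ) < Fintype.card (U → Fin k) := by
    have : Nonempty (Fin k) := ⟨⟨0, hk⟩⟩
    exact_mod_cast Fintype.card_pos
  refine le_of_mul_le_mul_left ?_ hc
  rw [mul_left_comm, ← Nat.cast_mul, ← Nat.cast_mul, h1, h2, Nat.cast_sum, Nat.cast_sum, mul_sum]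
  refine sum_le_sum fun f _ => ?_
  -- Overwriting on `U` does not alter the lists of vertices of `U`, so the number of short lists
  -- depends on `f` alone and may be conditioned on.
  by_cases hf : f ∈ properOn G k (A \ U) ∧
      (#{u ∈ U | #(freeColours G f (A \ U) u) < t} : ℝ) ≤ m
  · have hshort : (#{i : U | #(freeColours G f (A \ U) i) < t} : ℝ) ≤ m := by
      refine le_trans (le_of_eq ?_) hf.2
      rw [← card_map (Function.Embedding.subtype (· ∈ U))]
      congr 2
      ext x
      simp [and_comm]
    have := card_few_unused_le_of_few_short (fun i : U => freeColours G f (A \ U) i) t ht m D T r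
      hmk (by rw [Fintype.card_coe]; exact hD A v) hr hshort
    refine le_trans (Nat.cast_le.2 (card_le_card fun g hg => ?_)) (this.trans (le_of_eq ?_))
    · simp only [mem_filter, mem_univ, true_and] at hg ⊢
      rw [overwrite_mem_properOn hG, freeColours_overwrite_self] at hg
      exact ⟨hg.1.2, hg.2.2⟩
    · congr 3
      ext g
      simp only [mem_filter, mem_univ, true_and]
      rw [overwrite_mem_properOn hG]
      exact ⟨fun h => ⟨hf.1, h⟩, fun h => h.2⟩
  · have : ({g : U → Fin k | overwrite U f g ∈ properOn G k A ∧
        (#{u ∈ U | #(freeColours G (overwrite U f g) A u) < t} : ℝ) ≤ m ∧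
        (#(freeColours G (overwrite U f g) A v) : ℝ) < T} : Finset _) = ∅ := by
      rw [filter_eq_empty_iff]
      rintro g - ⟨h3, h4, -⟩
      refine hf ⟨((overwrite_mem_properOn hG f g).1 h3).1, ?_⟩
      refine le_trans (le_of_eq ?_) h4
      congr 2
      exact filter_congr fun u hu => by rw [freeColours_overwrite hG hu]
    rw [this]
    simp only [card_empty, Nat.cast_zero]
    positivity

/-- Markov's inequality: the expected number of short neighbours is at most 2Dtq/T, and `hDm` makes
this at most mq/2. -/
lemma card_many_short_le (hD : ∀ A v, (#(nbrsIn G A v) : ℝ) ≤ D)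
    (hk : 0 < k) (hm : 0 < m) (hT : 0 < T) (htT : (t : ℝ) ≤ T) (hq0 : 0 ≤ q) (hq : q ≤ 1 / 2)
    (hDm : 4 * D * t ≤ m * T) (A : Finset V) (v : V)
    (ih : ∀ u ∈ A, MostlyFree G k T q (A.erase u) u) :
    (#{f ∈ properOn G k A | m < (#{u ∈ nbrsIn G A v | #(freeColours G f A u) < t} : ℝ)} : ℝ) ≤
      q / 2 * #(properOn G k A) := by
  set U := nbrsIn G A v with hU
  have h1 : ∀ u ∈ U, T * (#{f ∈ properOn G k A | #(freeColours G f A u) < t} : ℝ) ≤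
      2 * t * q * #(properOn G k A) := by
    intro u hu
    have huA : u ∈ A := (mem_filter.1 hu).1
    have := (ih u huA).card_few_free_le hq htT hT hk (notMem_erase u A) hq0
    rw [insert_erase huA] at this
    have e : ∀ f : V → Fin k, freeColours G f (A.erase u) u = freeColours G f A u := fun f =>
      freeColours_congr (fun x hx => by simp [hx.ne']) fun _ _ _ => rfl
    simpa only [e] using this
  have h2 : m * (#{f ∈ properOn G k A | m < (#{u ∈ U | #(freeColours G f A u) < t} : ℝ)} : ℝ) ≤
      ∑ u ∈ U, (#{f ∈ properOn G k A | #(freeColours G f A u) < t} : ℝ) := by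
    rw [mul_comm, ← nsmul_eq_mul, ← sum_const]
    calc _ ≤ ∑ f ∈ properOn G k A, (#{u ∈ U | #(freeColours G f A u) < t} : ℝ) :=
          (sum_le_sum fun f hf => (mem_filter.1 hf).2.le).trans
            (sum_le_sum_of_subset_of_nonneg (filter_subset _ _) fun _ _ _ => by positivity)
      _ = _ := by
          simp only [card_filter, Nat.cast_sum]
          exact sum_comm
  have h3 : T * ∑ u ∈ U, (#{f ∈ properOn G k A | #(freeColours G f A u) < t} : ℝ) ≤
      D * (2 * t * q * #(properOn G k A)) := by
    rw [mul_sum]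
    refine (sum_le_sum h1).trans ?_
    rw [sum_const, nsmul_eq_mul]
    exact mul_le_mul_of_nonneg_right (hD A v) (by positivity)
  have h4 := mul_le_mul_of_nonneg_left h2 hT.le
  have h5 : 0 ≤ q / 2 * (#(properOn G k A) : ℝ) := by positivity
  have h6 := mul_le_mul_of_nonneg_right hDm h5
  refine le_of_mul_le_mul_left ?_ (mul_pos hm hT)
  linarith

theorem mostlyFree (hG : G.CliqueFree 3) (hD : ∀ A v, (#(nbrsIn G A v) : ℝ) ≤ D) (ht : 2 ≤ t)
    (hk : 0 < k) (hm : 0 < m) (hmk : t * m < k) (hT : 0 < T) (htT : (t : ℝ) ≤ T)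
    (hq0 : 0 ≤ q) (hq : q ≤ 1 / 2) (hDm : 4 * D * t ≤ m * T)
    (htail : Real.exp (T - (k - t * m) * Real.exp (-(D * (t / (t - 1)) / (k - t * m))) / 2) ≤
      q / 2) (A : Finset V) (v : V) (hv : v ∉ A) : MostlyFree G k T q A v := by
  induction A using Finset.strongInduction generalizing v with
  | H A ih =>
    have h1 := card_many_short_le hD hk hm hT htT hq0 hq hDm A v fun u hu =>
      ih _ (erase_ssubset hu) u (notMem_erase u A)
    have h2 := card_few_free_and_few_short_le hG hD ht hk hmk (by positivity) htail A v
    unfold MostlyFree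
    have h3 : #{f ∈ properOn G k A | (#(freeColours G f A v) : ℝ) < T} ≤
        #{f ∈ properOn G k A | m < (#{u ∈ nbrsIn G A v | #(freeColours G f A u) < t} : ℝ)} +
        #{f ∈ properOn G k A | (#{u ∈ nbrsIn G A v | #(freeColours G f A u) < t} : ℝ) ≤ m ∧
          (#(freeColours G f A v) : ℝ) < T} := by
      refine (card_le_card fun f hf => ?_).trans (card_union_le _ _)
      rw [mem_filter] at hf
      rw [mem_union, mem_filter, mem_filter]
      rcases lt_or_ge m (#{u ∈ nbrsIn G A v | #(freeColours G f A u) < t} : ℝ) with h | h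
      · exact Or.inl ⟨hf.1, h⟩
      · exact Or.inr ⟨hf.1, h, hf.2⟩
    have h4 : (#{f ∈ properOn G k A | (#(freeColours G f A v) : ℝ) < T} : ℝ) ≤ _ :=
      (Nat.cast_le.2 h3).trans (le_of_eq (Nat.cast_add _ _))
    linarith

lemma properOn_nonempty (hT : 0 < T) (hq : q ≤ 1 / 2) (hk : 0 < k)
    (h : ∀ A v, v ∉ A → MostlyFree G k T q A v) (A : Finset V) : (properOn G k A).Nonempty := by
  induction A using Finset.induction_on with
  | empty => exact ⟨fun _ => ⟨0, hk⟩, by simp [mem_properOn]⟩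
  | insert u A hu ih =>
    have h1 := (h A u hu).card_properOn_le hT hq hu
    have h2 : (0 : ℝ) < #(properOn G k A) := by exact_mod_cast ih.card_pos
    rw [← card_pos]
    by_contra h0
    have h3 : #(properOn G k (insert u A)) = 0 := by omega
    rw [h3] at h1
    push_cast at h1
    nlinarith

end PartialColourings

/-! ### From counting maps to the uniform colouring of the vertex-deleted graph. -/

section Transfer

variable {V : Type u} [Fintype V] [DecidableEq V] {G : SimpleGraph V} [DecidableRel G.Adj] {k : ℕ}

/-- Colourings that are proper off `v` are proper colourings of `G ∖ v` together with an arbitrary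
colour for `v`. -/
def properOnEquiv (G : SimpleGraph V) [DecidableRel G.Adj] (k : ℕ) (v : V) :
    {f // f ∈ properOn G k (univ.erase v)} ≃
      (deleteVertex G v).Coloring (Fin k) × Fin k where
  toFun f := (SimpleGraph.Coloring.mk (fun x => f.1 x) fun {x y} hxy =>
    mem_properOn.1 f.2 x (mem_erase.2 ⟨x.2, mem_univ _⟩) y
      (mem_erase.2 ⟨y.2, mem_univ _⟩) hxy, f.1 v)
  invFun p := ⟨fun x => if h : x = v then p.2 else p.1 ⟨x, h⟩, by
    refine mem_properOn.2 fun x hx y hy hxy => ?_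
    have hx' := ne_of_mem_erase hx
    have hy' := ne_of_mem_erase hy
    simp only [hx', hy', dif_neg, not_false_eq_true]
    exact p.1.valid hxy⟩
  left_inv f := by
    refine Subtype.ext (funext fun x => ?_)
    by_cases h : x = v
    · subst h; simp
    · simp [h]
      rfl
  right_inv p := by
    refine Prod.ext (DFunLike.ext _ _ fun x => ?_) (by simp)
    have hx : (x : V) ≠ v := x.2
    change (if h : (x : V) = v then p.2 else p.1 ⟨x, h⟩) = p.1 x
    rw [dif_neg hx]

lemma listSize_properOnEquiv (v : V) (f : {f // f ∈ properOn G k (univ.erase v)}) :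
    listSize G v (properOnEquiv G k v f).1 = #(freeColours G f.1 (univ.erase v) v) := by
  rw [listSize, ← Set.ncard_coe_finset]
  congr 1
  ext c
  simp only [availableColours, Set.mem_sdiff, Set.mem_univ, true_and, Set.mem_image,
    Set.mem_ofPred_eq, mem_coe, mem_freeColours, not_exists, not_and]
  constructor
  · intro h u hu hvu
    exact h ⟨u, ne_of_mem_erase hu⟩ hvu
  · rintro h ⟨u, hu⟩ hvu
    exact h u (mem_erase.2 ⟨hu, mem_univ u⟩) hvu

lemma card_filter_properOn_erase (v : V) (R : (V → Fin k) → Prop) [DecidablePred R]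
    (Q : (deleteVertex G v).Coloring (Fin k) → Prop)
    (hRQ : ∀ f, R f.1 ↔ Q (properOnEquiv G k v f).1) :
    #{f ∈ properOn G k (univ.erase v) | R f} = Nat.card {σ // Q σ} * k := by
  calc #{f ∈ properOn G k (univ.erase v) | R f}
      = Nat.card {f // f ∈ properOn G k (univ.erase v) ∧ R f} :=
        (Nat.subtype_card _ fun f => by simp).symm
    _ = Nat.card {x : {f // f ∈ properOn G k (univ.erase v)} // R x.1} :=
        Nat.card_congr (Equiv.subtypeSubtypeEquivSubtypeInter _ _).symm
    _ = Nat.card {p : (deleteVertex G v).Coloring (Fin k) × Fin k // Q p.1} :=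
        Nat.card_congr ((properOnEquiv G k v).subtypeEquiv hRQ)
    _ = Nat.card ({σ // Q σ} × Fin k) := Nat.card_congr Equiv.prodSubtypeFstEquivSubtypeProd
    _ = _ := by rw [Nat.card_prod, Nat.card_fin]

lemma nonempty_coloring_of_properOn (v : V) (h : (properOn G k (univ.erase v)).Nonempty) :
    Nonempty ((deleteVertex G v).Coloring (Fin k)) :=
  h.elim fun f hf => ⟨(properOnEquiv G k v ⟨f, hf⟩).1⟩

lemma prob_uniformColouring {W : Type u} [Finite W] (H : SimpleGraph W) (k : ℕ)
    [Nonempty (H.Coloring (Fin k))] (S : Set (H.Coloring (Fin k))) :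
    prob (uniformColouring H k) S = Nat.card S / Nat.card (H.Coloring (Fin k)) := by
  classical
  have : Finite (H.Coloring (Fin k)) := DFunLike.finite _
  let _ := Fintype.ofFinite (H.Coloring (Fin k))
  let _ := Fintype.ofFinite S
  rw [prob, uniformColouring, PMF.toOuterMeasure_uniformOfFintype_apply, ENNReal.toReal_div,
    Nat.card_eq_fintype_card, Nat.card_eq_fintype_card]
  simp

lemma MostlyFree.prob_le {T q : ℝ} {v : V} (hk : 0 < k)
    [Nonempty ((deleteVertex G v).Coloring (Fin k))]
    (h : MostlyFree G k T q (univ.erase v) v) :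
    prob (uniformColouring (deleteVertex G v) k) {σ | (listSize G v σ : ℝ) < T} ≤ q := by
  have : Finite ((deleteVertex G v).Coloring (Fin k)) := DFunLike.finite _
  have h1 := card_filter_properOn_erase v
    (fun f => (#(freeColours G f (univ.erase v) v) : ℝ) < T)
    (fun σ => (listSize G v σ : ℝ) < T) fun f => by
      rw [listSize_properOnEquiv (G := G) (k := k)]
  have h2 := card_filter_properOn_erase (G := G) (k := k) v (fun _ => True) (fun _ => True)
    fun f => Iff.rfl
  rw [filter_true, Nat.card_congr (Equiv.subtypeUnivEquiv fun _ => trivial)] at h2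
  unfold MostlyFree at h
  rw [h1, h2] at h
  push_cast at h
  have hk' : (0 : ℝ) < k := by exact_mod_cast hk
  rw [prob_uniformColouring, div_le_iff₀ (by exact_mod_cast Nat.card_pos)]
  refine le_of_mul_le_mul_right ?_ hk'
  rw [mul_assoc]
  exact h

end Transfer

/-! ### Asymptotic choice of parameters. -/

section Parameters

open Filter

/-- With T = k^(3ε/4)/8: T ≥ 3 gives 2e^(-T) ≤ 1/2, the bound with constant 32 gives 4Δt ≤ mT, and
the last two conditions give Δ^(ε/2) ≤ T. -/
lemma eventually_parameters (ε : ℝ) (hε : 0 < ε) (t : ℕ) :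
    ∀ᶠ k : ℕ in atTop, 0 < k ∧ (t : ℝ) ≤ (k : ℝ) ^ (3 * ε / 4) / 8 ∧
      3 ≤ (k : ℝ) ^ (3 * ε / 4) / 8 ∧
      32 * t * t / ε * Real.log k ≤ (k : ℝ) ^ (3 * ε / 4) / 8 ∧
      Real.log k ≤ (k : ℝ) ^ (1 / 4 : ℝ) ∧ 8 ≤ (k : ℝ) ^ (ε / 8) := by
  have hT : Tendsto (fun k : ℕ => (k : ℝ) ^ (3 * ε / 4) / 8) atTop atTop :=
    ((tendsto_rpow_atTop (by positivity)).comp tendsto_natCast_atTop_atTop).atTop_div_const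
      (by norm_num)
  have hlog : ∀ r : ℝ, 0 < r → ∀ c : ℝ, 0 < c →
      ∀ᶠ k : ℕ in atTop, Real.log k ≤ c * (k : ℝ) ^ r := by
    intro r hr c hc
    have := tendsto_natCast_atTop_atTop.eventually ((isLittleO_log_rpow_atTop hr).bound hc)
    filter_upwards [this] with k hk
    rw [Real.norm_of_nonneg (Real.rpow_nonneg (Nat.cast_nonneg k) r)] at hk
    exact (le_abs_self _).trans hk
  filter_upwards [eventually_gt_atTop 0, hT.eventually_ge_atTop (t : ℝ), hT.eventually_ge_atTop 3,
    hlog (3 * ε / 4) (by positivity) (1 / (8 * (32 * t * t / ε + 1))) (by positivity),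
    hlog (1 / 4) (by norm_num) 1 one_pos,
    ((tendsto_rpow_atTop (by positivity : 0 < ε / 8)).comp
      tendsto_natCast_atTop_atTop).eventually_ge_atTop 8] with k h1 h2 h3 h4 h5 h6
  refine ⟨h1, h2, h3, ?_, by simpa using h5, h6⟩
  have hc : 0 ≤ 32 * (t : ℝ) * t / ε := by positivity
  have hl : 0 ≤ Real.log k := Real.log_natCast_nonneg k
  rw [div_mul_eq_mul_div, one_mul, le_div_iff₀ (by positivity)] at h4
  rw [le_div_iff₀ (by norm_num)]
  nlinarith

/-- Since D ≤ k log k ≤ k^(5/4), the left side is at most k^(5ε/8); the spare k^(ε/8) absorbs the 8.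
-/
lemma rpow_half_le {ε k D : ℝ} (hε : 0 < ε) (hk : 0 < k) (hD0 : 0 ≤ D)
    (hD : D ≤ (1 - ε) * k * Real.log k) (hl : 0 ≤ Real.log k)
    (hlog : Real.log k ≤ k ^ (1 / 4 : ℝ)) (h8 : 8 ≤ k ^ (ε / 8)) :
    D ^ (ε / 2) ≤ k ^ (3 * ε / 4) / 8 := by
  have h1 : D ≤ k ^ (5 / 4 : ℝ) := by
    have e : k ^ (5 / 4 : ℝ) = k * k ^ (1 / 4 : ℝ) := by
      rw [show (5 / 4 : ℝ) = 1 + 1 / 4 by norm_num, Real.rpow_add hk, Real.rpow_one]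
    rw [e]
    calc D ≤ (1 - ε) * (k * Real.log k) := by linarith
      _ ≤ 1 * (k * Real.log k) :=
          mul_le_mul_of_nonneg_right (by linarith) (mul_nonneg hk.le hl)
      _ ≤ k * k ^ (1 / 4 : ℝ) := by
          rw [one_mul]; exact mul_le_mul_of_nonneg_left hlog hk.le
  have h2 : D ^ (ε / 2) ≤ k ^ (5 * ε / 8) := by
    refine (Real.rpow_le_rpow hD0 h1 (by positivity)).trans (le_of_eq ?_)
    rw [← Real.rpow_mul hk.le]
    congr 1; ring
  have e : k ^ (3 * ε / 4) = k ^ (5 * ε / 8) * k ^ (ε / 8) := by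
    rw [← Real.rpow_add hk]; congr 1; ring
  rw [e, le_div_iff₀ (by norm_num)]
  exact mul_le_mul h2 h8 (by norm_num) (Real.rpow_nonneg hk.le _)

/-- Finite list size and discarded colours cost factors 1 + ε/8 and 1 - ε/8. Of the slack ε in the
degree bound 3ε/4 survives, because (1-ε)(1+ε/8) ≤ (1-3ε/4)(1-ε/8). -/
lemma tail_exponent_le {ε k D t : ℝ} (hε : 0 < ε) (hε1 : ε < 1) (hk : 0 < k)
    (hD0 : 0 ≤ D) (hD : D ≤ (1 - ε) * k * Real.log k) (hl : 0 ≤ Real.log k)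
    (ht : 8 / ε ≤ t - 1) :
    2 * (k ^ (3 * ε / 4) / 8) ≤
      (k - ε / 8 * k) * Real.exp (-(D * (t / (t - 1)) / (k - ε / 8 * k))) / 2 := by
  have ht1 : 0 < t - 1 := lt_of_lt_of_le (by positivity) ht
  have hr : t / (t - 1) ≤ 1 + ε / 8 := by
    rw [div_le_iff₀ ht1]
    rw [div_le_iff₀ hε] at ht
    nlinarith
  have hκ : 0 < k - ε / 8 * k := by nlinarith
  have ha : D * (t / (t - 1)) / (k - ε / 8 * k) ≤ (1 - 3 * ε / 4) * Real.log k := by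
    rw [div_le_iff₀ hκ]
    have hkl : 0 ≤ k * Real.log k := mul_nonneg hk.le hl
    calc D * (t / (t - 1)) ≤ ((1 - ε) * k * Real.log k) * (1 + ε / 8) :=
          mul_le_mul hD hr (div_nonneg (by linarith) ht1.le) (hD0.trans hD)
      _ = (1 - ε) * (1 + ε / 8) * (k * Real.log k) := by ring
      _ ≤ (1 - 3 * ε / 4) * (1 - ε / 8) * (k * Real.log k) :=
          mul_le_mul_of_nonneg_right (by nlinarith) hkl
      _ = _ := by ring
  have he : k ^ (3 * ε / 4) ≤ k * Real.exp (-(D * (t / (t - 1)) / (k - ε / 8 * k))) := by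
    calc k ^ (3 * ε / 4) = k * Real.exp (-((1 - 3 * ε / 4) * Real.log k)) := by
          nth_rewrite 2 [← Real.exp_log hk]
          rw [← Real.exp_add, Real.rpow_def_of_pos hk]
          congr 1; ring
      _ ≤ _ := mul_le_mul_of_nonneg_left (Real.exp_le_exp.2 (neg_le_neg ha)) hk.le
  have hp : 0 < k ^ (3 * ε / 4) := Real.rpow_pos_of_pos hk _
  nlinarith

end Parameters

end SparseColouring

/-! ### Assembly of the main theorem. -/

open SparseColouring

theorem mainTheorem10 (ε : ℝ) (hε : ε ∈ Set.Ioo (0 : ℝ) 1) :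
    ∃ Δ₀ : ℕ, ∀ Δ : ℕ, Δ₀ ≤ Δ →
      ∀ k : ℕ, (Δ : ℝ) ≤ (1 - ε) * k * Real.log k →
      ∀ (V : Type u) [Fintype V] (G : SimpleGraph V) [DecidableRel G.Adj],
        G.CliqueFree 3 → G.maxDegree ≤ Δ →
      ∀ δ ∈ Set.Ioo (0 : ℝ) 1, ∀ v : V,
        ∃ _ : Nonempty ((SparseColouring.deleteVertex G v).Coloring (Fin k)),
          SparseColouring.prob
              (SparseColouring.uniformColouring (SparseColouring.deleteVertex G v) k)
              {σ | (SparseColouring.listSize G v σ : ℝ) < (1 - δ) * (Δ : ℝ) ^ (ε / 2)}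
            ≤ 2 * Real.exp (-(δ ^ 2 * (Δ : ℝ) ^ (ε / 2) / 2)) := by
  obtain ⟨hε0, hε1⟩ := hε
  set t : ℕ := ⌈8 / ε⌉₊ + 1 with ht
  obtain ⟨k₀, hk₀⟩ := Filter.eventually_atTop.1 (eventually_parameters ε hε0 t)
  -- Since Δ ≤ k log k ≤ k², a Δ above k₀² forces k ≥ k₀.
  refine ⟨k₀ ^ 2 + 1, fun Δ hΔ k hk V _ G _ hG hdeg δ hδ v => ?_⟩
  classical
  have hl : 0 ≤ Real.log k := Real.log_natCast_nonneg k
  have hkk : k₀ ≤ k := by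
    by_contra hlt
    push Not at hlt
    have h1 : Real.log k ≤ k := Real.log_le_self (Nat.cast_nonneg k)
    have h2 : (Δ : ℝ) ≤ k * k := by
      have hk0 : (0 : ℝ) ≤ k := Nat.cast_nonneg k
      have h3 : 0 ≤ (k : ℝ) * Real.log k := mul_nonneg hk0 hl
      nlinarith
    have h3 : Δ ≤ k * k := by exact_mod_cast h2
    nlinarith
  obtain ⟨hkpos, htT, hT3, hlogT, hlog4, h8⟩ := hk₀ k hkk
  set T : ℝ := (k : ℝ) ^ (3 * ε / 4) / 8 with hT
  have hk' : (0 : ℝ) < k := by exact_mod_cast hkpos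
  have ht1 : 8 / ε ≤ (t : ℝ) - 1 := by
    rw [ht]; push_cast
    linarith [Nat.le_ceil (8 / ε)]
  have ht2 : 2 ≤ t := by
    have : 0 < ⌈8 / ε⌉₊ := Nat.ceil_pos.2 (by positivity)
    omega
  have ht0 : (0 : ℝ) < t := by positivity
  have hTpos : 0 < T := by linarith
  -- Chosen so that `m` short lists cover at most an ε/8 fraction of the colours.
  set m : ℝ := ε / 8 * k / t with hm
  have htm : t * m = ε / 8 * k := by rw [hm]; field_simp
  have hD : ∀ A v, (Finset.card (nbrsIn G A v) : ℝ) ≤ Δ := by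
    intro A v
    have : nbrsIn G A v ⊆ G.neighborFinset v := fun x hx => by
      simpa using (Finset.mem_filter.1 hx).2
    exact_mod_cast (Finset.card_le_card this).trans ((G.degree_le_maxDegree v).trans hdeg)
  have hq : 2 * Real.exp (-T) ≤ 1 / 2 := by
    have h1 : 4 ≤ Real.exp T := by linarith [Real.add_one_le_exp T]
    rw [Real.exp_neg]
    have := inv_anti₀ (by norm_num) h1
    linarith
  have hfree : ∀ A v, v ∉ A → MostlyFree G k T (2 * Real.exp (-T)) A v := by
    refine mostlyFree (t := t) (m := m) (D := Δ) hG hD ht2 hkpos (by positivity) ?_ hTpos htT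
      (by positivity) hq ?_ ?_
    · rw [htm]; nlinarith
    · refine le_of_mul_le_mul_left ?_ ht0
      rw [← mul_assoc (t : ℝ) m T, htm]
      have h1 : (Δ : ℝ) ≤ k * Real.log k := by
        have h3 : 0 ≤ (k : ℝ) * Real.log k := mul_nonneg hk'.le hl
        nlinarith
      have h2 : 32 * t * t * Real.log k ≤ ε * T := by
        rw [div_mul_eq_mul_div, div_le_iff₀ hε0] at hlogT
        linarith
      have h3 := mul_le_mul_of_nonneg_left h1 (by positivity : (0 : ℝ) ≤ 4 * t * t)
      have h4 := mul_le_mul_of_nonneg_left h2 (by positivity : (0 : ℝ) ≤ k / 8)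
      linarith
    · rw [htm, mul_div_cancel_left₀ _ two_ne_zero]
      refine Real.exp_le_exp.2 ?_
      have := tail_exponent_le hε0 hε1 hk' (Nat.cast_nonneg Δ) hk hl ht1
      linarith
  have hne := nonempty_coloring_of_properOn v
    (properOn_nonempty hTpos hq hkpos hfree (Finset.univ.erase v))
  refine ⟨hne, ?_⟩
  have hprob := (hfree _ v (Finset.notMem_erase v Finset.univ)).prob_le hkpos
  have hℓ := rpow_half_le hε0 hk' (Nat.cast_nonneg Δ) hk hl hlog4 h8
  have hℓ0 : 0 ≤ (Δ : ℝ) ^ (ε / 2) := Real.rpow_nonneg (Nat.cast_nonneg Δ) _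
  obtain ⟨hδ0, hδ1⟩ := hδ
  -- As ℓ ≤ T, both (1-δ)ℓ ≤ T and δ²ℓ/2 ≤ T hold, so the threshold can be raised to `T` and the
  -- bound 2e^(-T) suffices.
  refine le_trans ?_ (hprob.trans ?_)
  · have : Finite ((deleteVertex G v).Coloring (Fin k)) := DFunLike.finite _
    rw [prob_uniformColouring, prob_uniformColouring]
    refine div_le_div_of_nonneg_right (Nat.cast_le.2 (Nat.card_mono (Set.toFinite _) ?_))
      (Nat.cast_nonneg _)
    refine Set.ofPred_subset_ofPred.2 fun σ hσ => lt_of_lt_of_le hσ ?_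
    nlinarith
  · refine mul_le_mul_of_nonneg_left (Real.exp_le_exp.2 ?_) (by norm_num)
    have : δ ^ 2 ≤ 1 := by nlinarith
    nlinarith
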